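/- Let $K$ be a field, let $n\ge 3$, and let $C_n$ be the cycle on the vertices $x_1,\dots,x_n$. Let $I=I_{n-2}(C_n)\subseteq S=K[x_1,\dots,x_n]$ be the ideal generated by the products $x_{i_1}\cdots x_{i_{n-2}}$ of the vertices of the paths of $C_n$ with $n-2$ vertices, that is, by the $n$ monomials $u_j=x_jx_{j+1}\cdots x_{j+n-3}$ (indices modulo $n$). Let $R(I)=S[u_1t,\dots,u_nt]\subseteq S[t]$ be the Rees algebra of $I$, graded by $\deg x_i=1$ and $\deg (u_jt)=1$ (the total degree of the bigrading with $\deg x_i=(1,0)$ and $\deg (u_jt)=(0,1)$), and let $\mathrm{HS}(R(I))=\sum_{d\ge 0}\dim_K R(I)_d\,z^d$ be its Hilbert series. Then: (a) if $n=2s+1$, then $$\mathrm{HS}(R(I))=\frac{\sum_{k=0}^{s-1}(1+z)^{2k+1}z^{s-1-k}+z^s}{(1-z)^{2s+2}};$$ (b) if $n=2s$, then $$\mathrm{HS}(R(I))=\frac{\sum_{k=0}^{s-1}(1+z)^{2k}z^{s-1-k}}{(1-z)^{2s+1}}.$$ -/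

import Mathlib

open Polynomial

noncomputable section

namespace PathRees

/-- The `t`-path ideal `I_t(G) = (x_{i_1} ⋯ x_{i_t} ∣ x_{i_1}, …, x_{i_t} is a t-path of G)` of a
simple graph `G`, in the polynomial ring `K[x_v : v ∈ V]`. A `t`-path is a path of `G` on `t`
vertices. -/
def pathIdeal {V : Type*} (K : Type*) [Field K] (G : SimpleGraph V) (t : ℕ) :
    Ideal (MvPolynomial V K) :=
  Ideal.span {f | ∃ (u v : V) (p : G.Walk u v), p.IsPath ∧ p.support.length = t ∧
    f = (p.support.map (fun w => (MvPolynomial.X w : MvPolynomial V K))).prod}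

/-- The component of bidegree `(a, b)` of the Rees algebra `R(I) = ⨁ I^b s^b ⊆ S[s]` of an ideal
`I = (u_1, …, u_m)` of `S = K[x_v : v ∈ V]` generated by forms of the same degree `e`, for the
bigrading with `deg x_v = (1, 0)` and `deg (u_j s) = (0, 1)`: it consists of the elements `f s^b`
of `R(I)` with `f ∈ S` homogeneous of degree `a + e b`. -/
def reesBidegree {V K : Type*} [Field K] (I : Ideal (MvPolynomial V K)) (e a b : ℕ) :
    Submodule K (reesAlgebra I) where
  carrier := {q | ∃ f : MvPolynomial V K, f.IsHomogeneous (a + e * b) ∧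
    (q : (MvPolynomial V K)[X]) = Polynomial.monomial b f}
  zero_mem' := ⟨0, MvPolynomial.isHomogeneous_zero _ _ _, by simp⟩
  add_mem' := by
    rintro p q ⟨f, hf, hp⟩ ⟨g, hg, hq⟩
    exact ⟨f + g, hf.add hg, by simp [hp, hq]⟩
  smul_mem' := by
    rintro c q ⟨f, hf, hq⟩
    refine ⟨c • f, (MvPolynomial.homogeneousSubmodule V K _).smul_mem c hf, ?_⟩
    change c • (q : (MvPolynomial V K)[X]) = _
    rw [hq, Polynomial.smul_monomial]

/-- The component of total degree `d` of `R(I)`: the sum of the components of bidegree `(a, b)`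
with `a + b = d`. -/
def reesDegree {V K : Type*} [Field K] (I : Ideal (MvPolynomial V K)) (e d : ℕ) :
    Submodule K (reesAlgebra I) :=
  ⨆ ab ∈ Finset.HasAntidiagonal.antidiagonal d, reesBidegree I e ab.1 ab.2

/-- The Hilbert series `∑_d dim_K R(I)_d z^d` of the Rees algebra of an ideal generated by forms of
degree `e`, with respect to the total degree. -/
def reesHilbertSeries {V K : Type*} [Field K] (I : Ideal (MvPolynomial V K)) (e : ℕ) :
    PowerSeries ℚ :=
  PowerSeries.mk fun d => (Module.finrank K (reesDegree I e d) : ℚ)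

end PathRees

end

/-! Each generator of `I` is the product of all variables off one edge of the cycle. So `x^m` lies
in `I^b` iff there are integral edge weights `e ≥ 0` of total `b` with `c k ≤ e k + e (k + 1)`,
where `c k = b - m k`: an edge cover of the demand `c`. The monomial `x^m t^b` has total degree `3 b
- ∑ c`, and for a fixed `c` the admissible `b` are those from the least cover weight `ν(c)` on.
Hence the series is `(∑_c z^(3 ν(c) - ∑ c)) / (1 - z^3)`, over all `c : Fin n → ℤ`
(`hasGenFun_cover`, `reesHilbertSeries_eq`).

To count demands, cover greedily: `e (k + 1) = (c k - e k)⁺`. A start `p` fixed by the return map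
`T` of one turn gives an optimal cover, encoded by `h : Fin n → ℤ` with weights `h⁺` and slacks
`h⁻`; the exponent is then `∑ |h k|`. Each greedy step reverses order and is 1-Lipschitz.

For `n = 2s`, `T` is monotone and has a fixed point. Taking the least one removes exactly the
shiftable `h`, so the numerator over `(1 - z)^n` is `(1 + z)^n - z^s`.

For `n = 2s + 1`, `T` is antitone. It has a single fixed point, or else it swaps two consecutive
integers. The second kind of demand has a half-integral fractional cover and contributes `z^(s +
2)`, giving `(1 + z)^n + z^(s + 2)`.

Both numerators then simplify through `1 + z + z² = (1 + z)² - z`. -/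

namespace PathRees

/-! ### Generating functions of weighted sets -/

/-- `f` is the generating function that counts the elements of `α` by the weight `w`; all weight
classes are required to be finite. -/
structure HasGenFun {α : Type*} (w : α → ℕ) (f : PowerSeries ℚ) : Prop where
  finite : ∀ d, Finite {a // w a = d}
  coeff_eq : ∀ d, PowerSeries.coeff d f = Nat.card {a // w a = d}

namespace HasGenFun

variable {α β γ : Type*} {w : α → ℕ} {w' : β → ℕ} {w'' : γ → ℕ} {f g : PowerSeries ℚ}

theorem congr (h : HasGenFun w f) (e : α ≃ β) (he : ∀ a, w' (e a) = w a) : HasGenFun w' f := by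
  have E : ∀ d, {a // w a = d} ≃ {b // w' b = d} := fun d =>
    e.subtypeEquiv fun a => by rw [he]
  refine ⟨fun d => ?_, fun d => ?_⟩
  · have := h.finite d
    exact Finite.of_equiv _ (E d)
  · rw [h.coeff_eq, Nat.card_congr (E d)]

theorem sum (hf : HasGenFun w f) (hg : HasGenFun w' g) :
    HasGenFun (Sum.elim w w') (f + g) := by
  have E : ∀ d, {a // Sum.elim w w' a = d} ≃ {a // w a = d} ⊕ {b // w' b = d} := fun d =>
    Equiv.subtypeSum
  refine ⟨fun d => ?_, fun d => ?_⟩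
  · have := hf.finite d
    have := hg.finite d
    exact Finite.of_equiv _ (E d).symm
  · have := hf.finite d
    have := hg.finite d
    rw [Nat.card_congr (E d), Nat.card_sum, map_add, hf.coeff_eq, hg.coeff_eq]
    push_cast
    rfl

theorem sub (hf : HasGenFun w'' f) (hg : HasGenFun w' g) (e : α ⊕ β ≃ γ)
    (he : ∀ a, w'' (e (Sum.inl a)) = w a) (he' : ∀ b, w'' (e (Sum.inr b)) = w' b) :
    HasGenFun w (f - g) := by
  have E : ∀ d, {c // w'' c = d} ≃ {a // w a = d} ⊕ {b // w' b = d} := fun d =>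
    ((e.subtypeEquiv (p := fun a => Sum.elim w w' a = d) fun a => by
      cases a <;> simp [he, he']).symm).trans Equiv.subtypeSum
  have fin : ∀ d, Finite {a // w a = d} := fun d => by
    have := hf.finite d
    have := Finite.of_equiv _ (E d)
    exact Finite.sum_left {b // w' b = d}
  refine ⟨fin, fun d => ?_⟩
  have := fin d
  have := hg.finite d
  rw [map_sub, hf.coeff_eq, hg.coeff_eq, Nat.card_congr (E d), Nat.card_sum]
  push_cast
  ring

theorem prod (hf : HasGenFun w f) (hg : HasGenFun w' g) :
    HasGenFun (fun p : α × β => w p.1 + w' p.2) (f * g) := by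
  have E : ∀ d, {p : α × β // w p.1 + w' p.2 = d} ≃
      Σ ij : Finset.HasAntidiagonal.antidiagonal d, {a // w a = ij.1.1} × {b // w' b = ij.1.2} := fun d =>
    { toFun := fun p => ⟨⟨(w p.1.1, w' p.1.2), Finset.HasAntidiagonal.mem_antidiagonal.2 p.2⟩,
        ⟨p.1.1, rfl⟩, ⟨p.1.2, rfl⟩⟩
      invFun := fun q => ⟨(q.2.1.1, q.2.2.1), by
        rw [q.2.1.2, q.2.2.2]
        exact Finset.HasAntidiagonal.mem_antidiagonal.1 q.1.2⟩
      left_inv := fun p => rfl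
      right_inv := by
        rintro ⟨⟨⟨i, j⟩, h⟩, ⟨a, ha⟩, ⟨b, hb⟩⟩
        dsimp only at ha hb
        subst ha hb
        rfl }
  have := hf.finite
  have := hg.finite
  refine ⟨fun d => Finite.of_equiv _ (E d).symm, fun d => ?_⟩
  rw [Nat.card_congr (E d), Nat.card_sigma, PowerSeries.coeff_mul,
    Finset.sum_coe_sort (Finset.HasAntidiagonal.antidiagonal d)
      (fun ij : ℕ × ℕ => Nat.card ({a // w a = ij.1} × {b // w' b = ij.2}))]
  push_cast
  refine Finset.sum_congr rfl fun ij _ => ?_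
  rw [hf.coeff_eq, hg.coeff_eq, Nat.card_prod]
  push_cast
  rfl

theorem add_const (hf : HasGenFun w f) (k : ℕ) :
    HasGenFun (fun a => w a + k) (f * PowerSeries.X ^ k) := by
  have hk : HasGenFun (fun _ : Unit => k) (PowerSeries.X ^ k) := by
    refine ⟨fun d => inferInstance, fun d => ?_⟩
    rw [PowerSeries.coeff_X_pow]
    split_ifs with h
    · subst h
      simp
    · have : IsEmpty {_u : Unit // k = d} := ⟨fun a => h a.2.symm⟩
      simp
  exact (hf.prod hk).congr (Equiv.prodPUnit α) fun a => rfl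

theorem pi (hf : HasGenFun w f) (n : ℕ) :
    HasGenFun (fun a : Fin n → α => ∑ i, w (a i)) (f ^ n) := by
  induction n with
  | zero =>
    refine ⟨fun d => inferInstance, fun d => ?_⟩
    rw [pow_zero, PowerSeries.coeff_one]
    split_ifs with h
    · subst h
      simp
    · have : IsEmpty {a : Fin 0 → α // ∑ i, w (a i) = d} := ⟨fun a => h (by simpa using a.2.symm)⟩
      rw [Nat.card_of_isEmpty, Nat.cast_zero]
  | succ n ih =>
    rw [pow_succ']
    refine (hf.prod ih).congr (Fin.consEquiv fun _ => α) fun a => ?_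
    simp [Fin.sum_univ_succ]

theorem nat : HasGenFun (fun a : ℕ => a) (1 - PowerSeries.X : PowerSeries ℚ)⁻¹ := by
  have : (1 - PowerSeries.X : PowerSeries ℚ)⁻¹ = PowerSeries.mk 1 := by
    rw [eq_comm, PowerSeries.eq_inv_iff_mul_eq_one (by simp)]
    exact PowerSeries.mk_one_mul_one_sub_eq_one ℚ
  refine ⟨fun d => inferInstance, fun d => ?_⟩
  rw [this]
  simp

/-- Accounts for the surplus of a cover over the least one: each extra unit of total weight costs
degree 3. -/
theorem three_mul : HasGenFun (fun a : ℕ => 3 * a)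
    (1 - PowerSeries.X ^ 3 : PowerSeries ℚ)⁻¹ := by
  have sub : ∀ d, Subsingleton {a : ℕ // 3 * a = d} := fun d =>
    ⟨fun a b => Subtype.ext (by have := a.2; have := b.2; omega)⟩
  have : (1 - PowerSeries.X ^ 3 : PowerSeries ℚ)⁻¹ =
      PowerSeries.mk fun d => (Nat.card {a : ℕ // 3 * a = d} : ℚ) := by
    rw [eq_comm, PowerSeries.eq_inv_iff_mul_eq_one (by simp), mul_sub, mul_one]
    ext d
    rw [map_sub, PowerSeries.coeff_mul_X_pow', PowerSeries.coeff_one]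
    simp only [PowerSeries.coeff_mk]
    by_cases h3 : 3 ≤ d
    · rw [if_pos h3, if_neg (by omega), sub_eq_zero, Nat.cast_inj]
      refine Nat.card_congr ⟨fun a => ⟨a.1 - 1, ?_⟩, fun a => ⟨a.1 + 1, ?_⟩, fun a => ?_, fun a => ?_⟩
      · have := a.2; omega
      · have := a.2; omega
      · exact Subsingleton.elim _ _
      · exact Subsingleton.elim _ _
    · rw [if_neg h3, sub_zero]
      split_ifs with h0
      · subst h0
        have : Nonempty {a : ℕ // 3 * a = 0} := ⟨⟨0, rfl⟩⟩
        simp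
      · have : IsEmpty {a : ℕ // 3 * a = d} := ⟨fun a => by have := a.2; omega⟩
        simp
  refine ⟨fun d => inferInstance, fun d => ?_⟩
  rw [this, PowerSeries.coeff_mk]

theorem int_natAbs : HasGenFun Int.natAbs
    ((1 + PowerSeries.X) * (1 - PowerSeries.X : PowerSeries ℚ)⁻¹) := by
  have h := nat.sum (nat.add_const 1)
  have e : (1 - PowerSeries.X : PowerSeries ℚ)⁻¹ + (1 - PowerSeries.X)⁻¹ * PowerSeries.X ^ 1 =
      (1 + PowerSeries.X) * (1 - PowerSeries.X : PowerSeries ℚ)⁻¹ := by ring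
  rw [e] at h
  refine h.congr Equiv.intEquivNatSumNat.symm ?_
  rintro (a | a)
  · rfl
  · rfl

end HasGenFun

/-! ### Sequences in the cyclic group -/

section Cyclic

variable {n : ℕ} [NeZero n]

theorem ofNat_succ (k : ℕ) : Fin.ofNat n (k + 1) = Fin.ofNat n k + 1 := by
  apply Fin.ext
  simp [Fin.val_add, Fin.ofNat]

theorem ofNat_val (i : Fin n) : Fin.ofNat n i.val = i := by
  apply Fin.ext
  simp [Fin.ofNat, Nat.mod_eq_of_lt i.isLt]

theorem ofNat_self : Fin.ofNat n n = 0 := by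
  apply Fin.ext
  simp [Fin.ofNat]

theorem ofNat_zero_eq : Fin.ofNat n 0 = 0 := by
  apply Fin.ext
  simp [Fin.ofNat]

theorem val_ofNat_of_lt {k : ℕ} (hk : k < n) : (Fin.ofNat n k).val = k := by
  simp [Fin.ofNat, Nat.mod_eq_of_lt hk]

theorem ofNat_ne_zero {k : ℕ} (h0 : k ≠ 0) (hk : k < n) : Fin.ofNat n k ≠ 0 := fun h => by
  have := congrArg Fin.val h
  rw [val_ofNat_of_lt hk] at this
  exact h0 (by simpa using this)

theorem val_add_one_cases (i : Fin n) :
    ((i + 1).val = i.val + 1 ∧ i.val + 1 < n) ∨ (i + 1 = 0 ∧ i.val + 1 = n) := by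
  have h := ofNat_succ (n := n) i.val
  rw [ofNat_val] at h
  rcases Nat.lt_or_ge (i.val + 1) n with h1 | h1
  · exact Or.inl ⟨by rw [← h, val_ofNat_of_lt h1], h1⟩
  · have h2 : i.val + 1 = n := by have := i.isLt; omega
    exact Or.inr ⟨by rw [← h, h2, ofNat_self], h2⟩

theorem sum_add_one {M : Type*} [AddCommMonoid M] (f : Fin n → M) :
    ∑ i, f (i + 1) = ∑ i, f i :=
  Equiv.sum_comp (Equiv.addRight 1) f

theorem sum_range_ofNat {M : Type*} [AddCommMonoid M] (f : Fin n → M) (i : Fin n) :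
    ∑ k ∈ Finset.range n, f (i + Fin.ofNat n k) = ∑ j, f j := by
  rw [Finset.sum_range]
  simp only [ofNat_val]
  exact Equiv.sum_comp (Equiv.addLeft i) f

end Cyclic

/-- A two-step induction: the last term either vanishes or is dominated together with its
predecessor. It shows that a greedy cover starting at an edge of weight zero is optimal. -/
theorem sum_range_le_sum_range_of_cover {d e : ℕ → ℕ} (h0 : d 0 = 0)
    (h : ∀ k, d (k + 1) = 0 ∨ d (k + 1) + d k ≤ e k + e (k + 1)) (m : ℕ) :
    ∑ j ∈ Finset.range m, d j ≤ ∑ j ∈ Finset.range m, e j := by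
  suffices H : ∀ m, ∑ j ∈ Finset.range m, d j ≤ ∑ j ∈ Finset.range m, e j ∧
      ∑ j ∈ Finset.range (m + 1), d j ≤ ∑ j ∈ Finset.range (m + 1), e j from (H m).1
  intro m
  induction m with
  | zero => simp [h0]
  | succ m ih =>
    refine ⟨ih.2, ?_⟩
    have h1 := ih.1
    have h2 := ih.2
    have h3 := h m
    simp only [Finset.sum_range_succ] at h1 h2 ⊢
    omega

/-! ### Orbits of a greedy edge cover along a path -/

/-- The weights of the greedy edge cover of the demands `c` along an infinite path, starting from
the weight `p` on the first edge. -/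
def orbit (c : ℕ → ℤ) (p : ℕ) : ℕ → ℕ
  | 0 => p
  | k + 1 => (c k - orbit c p k).toNat

@[simp] theorem orbit_zero (c : ℕ → ℤ) (p : ℕ) : orbit c p 0 = p := rfl

theorem orbit_succ (c : ℕ → ℤ) (p k : ℕ) : orbit c p (k + 1) = (c k - orbit c p k).toNat := rfl

/-- The map `x ↦ (c - x)⁺` reverses order and does not increase distances; iterate it. -/
theorem orbit_alternating (c : ℕ → ℤ) {p q : ℕ} (h : p ≤ q) (k : ℕ) :
    (Even k → orbit c p k ≤ orbit c q k ∧ orbit c q k + p ≤ orbit c p k + q) ∧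
    (¬ Even k → orbit c q k ≤ orbit c p k ∧ orbit c p k + p ≤ orbit c q k + q) := by
  induction k with
  | zero => simp [h, add_comm]
  | succ k ih =>
    rw [Nat.even_add_one]
    simp only [orbit_succ]
    refine ⟨fun hk => ?_, fun hk => ?_⟩
    · have := ih.2 hk
      omega
    · have := ih.1 (not_not.1 hk)
      omega

theorem orbit_antitone_of_odd (c : ℕ → ℤ) {p q n : ℕ} (hn : ¬ Even n) (h : p ≤ q) :
    orbit c q n ≤ orbit c p n :=
  ((orbit_alternating c h n).2 hn).1

/-- The distance between two orbits never grows, so if it is intact after `n` steps it was intact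
all along. -/
theorem orbit_diff_eq (c : ℕ → ℤ) {p q n k : ℕ} (h : p ≤ q)
    (hn : ((orbit c q n : ℤ) - orbit c p n).natAbs = q - p) (hk : k ≤ n) :
    (Even k → orbit c q k = orbit c p k + (q - p)) ∧
    (¬ Even k → orbit c p k = orbit c q k + (q - p)) := by
  have anti : Antitone fun k => ((orbit c q k : ℤ) - orbit c p k).natAbs := by
    refine antitone_nat_of_succ_le fun k => ?_
    simp only [orbit_succ]
    omega
  have h1 := anti hk
  have h2 := anti (Nat.zero_le k)
  have h3 := orbit_alternating c h k
  simp only [orbit_zero] at h1 h2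
  refine ⟨fun hk => ?_, fun hk => ?_⟩
  · have := h3.1 hk
    omega
  · have := h3.2 hk
    omega

theorem exists_least_orbit_le (c : ℕ → ℤ) {n : ℕ} (hn : n ≠ 0) :
    ∃ p, orbit c p n ≤ p ∧ ∀ q, orbit c q n ≤ q → p ≤ q := by
  have ex : ∃ p, orbit c p n ≤ p := by
    obtain ⟨m, rfl⟩ := Nat.exists_eq_succ_of_ne_zero hn
    -- The last greedy step never exceeds its own demand, whatever came before.
    exact ⟨(c m).toNat, by rw [orbit_succ]; omega⟩
  classical
  exact ⟨Nat.find ex, Nat.find_spec ex, fun q hq => Nat.find_min' ex hq⟩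

theorem hasGenFun_sum_natAbs (n : ℕ) :
    HasGenFun (fun h : Fin n → ℤ => ∑ k, (h k).natAbs)
      (((1 + PowerSeries.X) * (1 - PowerSeries.X)⁻¹) ^ n) :=
  HasGenFun.int_natAbs.pi n

theorem hasGenFun_sum (n : ℕ) : HasGenFun (fun f : Fin n → ℕ => ∑ k, f k)
    ((1 - PowerSeries.X : PowerSeries ℚ)⁻¹ ^ n) :=
  HasGenFun.nat.pi n

/-! ### Integral edge covers of a cycle -/

section Cover

variable {n : ℕ} [NeZero n]

/-- The weights `e` on the edges of the cycle cover the demands `c` of its vertices. The vertex `k`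
lies on the edges `k` and `k + 1`. -/
def IsCover (c : Fin n → ℤ) (e : Fin n → ℕ) : Prop := ∀ k, c k ≤ e k + e (k + 1)

theorem exists_isCover (c : Fin n → ℤ) : ∃ e, IsCover c e :=
  ⟨fun k => (c k).toNat, fun k => by dsimp only; omega⟩

/-- The least total weight of an integral edge cover of the demands `c`. -/
noncomputable def coverNumber (c : Fin n → ℤ) : ℕ := sInf {b | ∃ e, IsCover c e ∧ ∑ k, e k = b}

theorem exists_isCover_coverNumber (c : Fin n → ℤ) :
    ∃ e, IsCover c e ∧ ∑ k, e k = coverNumber c := by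
  obtain ⟨e, he⟩ := exists_isCover c
  exact Nat.sInf_mem (s := {b | ∃ e, IsCover c e ∧ ∑ k, e k = b}) ⟨_, e, he, rfl⟩

theorem coverNumber_le {c : Fin n → ℤ} {e : Fin n → ℕ} (he : IsCover c e) :
    coverNumber c ≤ ∑ k, e k :=
  Nat.sInf_le ⟨e, he, rfl⟩

theorem coverNumber_eq {c : Fin n → ℤ} {e : Fin n → ℕ} (he : IsCover c e)
    (h : ∀ e', IsCover c e' → ∑ k, e k ≤ ∑ k, e' k) : coverNumber c = ∑ k, e k := by
  obtain ⟨e', he', hs⟩ := exists_isCover_coverNumber c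
  exact le_antisymm (coverNumber_le he) (hs ▸ h e' he')

theorem exists_isCover_sum_eq_iff {c : Fin n → ℤ} {b : ℕ} :
    (∃ e, IsCover c e ∧ ∑ k, e k = b) ↔ coverNumber c ≤ b := by
  refine ⟨?_, fun h => ?_⟩
  · rintro ⟨e, he, rfl⟩
    exact coverNumber_le he
  · obtain ⟨e, he, hs⟩ := exists_isCover_coverNumber c
    -- The surplus is put on edge `0`.
    refine ⟨fun k => e k + if k = 0 then b - coverNumber c else 0, fun k => ?_, ?_⟩
    · have := he k
      push_cast
      split_ifs <;> omega
    · rw [Finset.sum_add_distrib, hs]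
      simp [h]

theorem IsCover.sum_le {c : Fin n → ℤ} {e : Fin n → ℕ} (he : IsCover c e) :
    ∑ k, c k ≤ 2 * ∑ k, (e k : ℤ) := by
  calc ∑ k, c k ≤ ∑ k, ((e k : ℤ) + e (k + 1)) := Finset.sum_le_sum fun k _ => he k
    _ = _ := by rw [Finset.sum_add_distrib, sum_add_one fun k => (e k : ℤ)]; ring

theorem sum_le_two_mul_coverNumber (c : Fin n → ℤ) : ∑ k, c k ≤ 2 * (coverNumber c : ℤ) := by
  obtain ⟨e, he, hs⟩ := exists_isCover_coverNumber c
  have := he.sum_le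
  rw [← hs]
  push_cast
  exact this

/-- The degree of the least covering multiple of a demand. -/
noncomputable def coverWeight (c : Fin n → ℤ) : ℕ := (3 * (coverNumber c : ℤ) - ∑ k, c k).toNat

/-- The demands that are covered greedily by the positive parts of `h`, with slacks the negative
parts of `h`. -/
def demand (h : Fin n → ℤ) : Fin n → ℤ := fun k => h (k + 1) + (h k).toNat

theorem isCover_demand (h : Fin n → ℤ) : IsCover (demand h) fun k => (h k).toNat := by
  intro k
  simp only [demand]
  omega

theorem sum_demand (h : Fin n → ℤ) : ∑ k, demand h k = ∑ k, (h k + (h k).toNat) := by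
  simp only [demand, Finset.sum_add_distrib]
  rw [sum_add_one h]

/-- If no `h k` is negative there is no slack, and double counting is sharp. Otherwise the cycle is
cut at an edge of weight zero and the greedy cover of a path is compared with `e`. -/
theorem sum_le_of_isCover_demand (h : Fin n → ℤ) {e : Fin n → ℕ} (he : IsCover (demand h) e) :
    ∑ k, (h k).toNat ≤ ∑ k, e k := by
  by_cases hpos : ∀ k, 0 ≤ h k
  · have h1 := he.sum_le
    have h2 : ∑ k, demand h k = 2 * ∑ k, ((h k).toNat : ℤ) := by
      rw [sum_demand, Finset.mul_sum]
      refine Finset.sum_congr rfl fun k _ => ?_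
      have := hpos k
      omega
    rw [h2] at h1
    zify
    omega
  · push Not at hpos
    obtain ⟨i, hi⟩ := hpos
    rw [← sum_range_ofNat _ i, ← sum_range_ofNat e i]
    refine sum_range_le_sum_range_of_cover ?_ (fun k => ?_) n
    · rw [ofNat_zero_eq, add_zero]
      omega
    · have := he (i + Fin.ofNat n k)
      simp only [demand] at this
      rw [ofNat_succ, ← add_assoc]
      omega

theorem coverNumber_demand (h : Fin n → ℤ) : coverNumber (demand h) = ∑ k, (h k).toNat :=
  coverNumber_eq (isCover_demand h) fun _ he => sum_le_of_isCover_demand h he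

theorem coverWeight_demand (h : Fin n → ℤ) : coverWeight (demand h) = ∑ k, (h k).natAbs := by
  have : (3 * (coverNumber (demand h) : ℤ) - ∑ k, demand h k) = ((∑ k, (h k).natAbs : ℕ) : ℤ) := by
    rw [coverNumber_demand, sum_demand]
    rw [Nat.cast_sum, Nat.cast_sum, Finset.mul_sum, ← Finset.sum_sub_distrib]
    -- Termwise, `3 h⁺ - (h + h⁺) = |h|`.
    exact Finset.sum_congr rfl fun k _ => by omega
  rw [coverWeight, this, Int.toNat_natCast]

theorem hasGenFun_cover {f : PowerSeries ℚ} (hf : HasGenFun (coverWeight (n := n)) f) :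
    HasGenFun (fun p : {p : (Fin n → ℤ) × ℕ // ∃ e, IsCover p.1 e ∧ ∑ k, e k = p.2} =>
      (3 * (p.1.2 : ℤ) - ∑ k, p.1.1 k).toNat) (f * (1 - PowerSeries.X ^ 3)⁻¹) := by
  refine (hf.prod HasGenFun.three_mul).congr
    { toFun := fun p => ⟨(p.1, coverNumber p.1 + p.2),
        exists_isCover_sum_eq_iff.2 (Nat.le_add_right _ _)⟩
      invFun := fun p => (p.1.1, p.1.2 - coverNumber p.1.1)
      left_inv := fun p => by simp
      right_inv := fun p => by
        have := exists_isCover_sum_eq_iff.1 p.2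
        refine Subtype.ext (Prod.ext rfl ?_)
        dsimp only
        omega } fun p => ?_
  -- Ensures that the truncation `toNat` in the weights loses nothing.
  have := sum_le_two_mul_coverNumber p.1
  simp only [Equiv.coe_fn_mk, coverWeight]
  omega

/-! ### Demands and orbits -/

/-- The periodic sequence of demands along the universal cover of the cycle. -/
def unroll (c : Fin n → ℤ) : ℕ → ℤ := fun k => c (Fin.ofNat n k)

theorem orbit_demand (h : Fin n → ℤ) (k : ℕ) :
    orbit (unroll (demand h)) (h 0).toNat k = (h (Fin.ofNat n k)).toNat := by
  induction k with
  | zero => rw [ofNat_zero_eq, orbit_zero]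
  | succ k ih =>
    rw [orbit_succ, ih, ofNat_succ]
    simp [unroll, demand]

theorem orbit_demand_self (h : Fin n → ℤ) :
    orbit (unroll (demand h)) (h 0).toNat n = (h 0).toNat := by
  rw [orbit_demand, ofNat_self]

theorem eq_of_demand_eq {h h' : Fin n → ℤ} (e : demand h = demand h')
    (e0 : (h 0).toNat = (h' 0).toNat) : h = h' := by
  have key : ∀ k, (h k).toNat = (h' k).toNat := fun k => by
    rw [← ofNat_val k, ← orbit_demand h, ← orbit_demand h', e, e0]
  funext k
  have := congrFun e (k - 1)
  simp only [demand, sub_add_cancel, key] at this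
  omega

theorem exists_demand_eq {c : Fin n → ℤ} {p : ℕ} (hp : orbit (unroll c) p n = p) :
    ∃ h, demand h = c ∧ (h 0).toNat = p := by
  have key : ∀ i : Fin n, (c i - orbit (unroll c) p i.val).toNat =
      orbit (unroll c) p (i + 1).val := by
    intro i
    have h1 := orbit_succ (unroll c) p i.val
    rw [unroll, ofNat_val] at h1
    rw [← h1]
    rcases val_add_one_cases i with ⟨h2, -⟩ | ⟨h2, h3⟩
    · rw [h2]
    · rw [h2, h3, hp]
      rfl
  -- The greedy step before truncation: its positive part is the next weight, its negative part the
  -- slack. The hypothesis `hp` closes the cycle.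
  refine ⟨fun k => c (k - 1) - orbit (unroll c) p (k - 1).val, funext fun k => ?_, ?_⟩
  · have := key (k - 1)
    rw [sub_add_cancel] at this
    simp only [demand, add_sub_cancel_right, this]
    ring
  · have := key (0 - 1)
    rw [sub_add_cancel] at this
    rw [this]
    rfl

/-! ### Cycles of even length -/

/-- The sequences that can be lowered at the even and raised at the odd vertices without a change
of the demands. -/
def IsShiftable (h : Fin n → ℤ) : Prop := ∀ k, if Even k.val then 1 ≤ h k else 0 ≤ h k

theorem even_val_add_one_iff (hn : Even n) (k : Fin n) : Even (k + 1).val ↔ ¬ Even k.val := by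
  rcases val_add_one_cases k with ⟨h, -⟩ | ⟨h, h'⟩
  · rw [h, Nat.even_add_one]
  · rw [h, ← Nat.even_add_one, h']
    simp [hn]

/-- Two starts fixed by the return map keep their full gap along the cycle, with alternating sign.
The larger one is thus positive at even places, and at odd places the smaller one has room to come
down by the gap. -/
theorem isShiftable_of_demand_eq (hn : Even n) {h h' : Fin n → ℤ} (e : demand h = demand h')
    (h0 : (h' 0).toNat < (h 0).toNat) : IsShiftable h := by
  have key := fun k (hk : k ≤ n) => orbit_diff_eq (unroll (demand h)) (k := k) h0.le (n := n) (by
    have := orbit_demand_self h'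
    rw [← e] at this
    rw [orbit_demand_self, this]
    omega) hk
  have o1 := orbit_demand h
  have o2 := orbit_demand h'
  rw [← e] at o2
  have key' : ∀ i : Fin n, (Even i.val → (h i).toNat = (h' i).toNat + ((h 0).toNat - (h' 0).toNat)) ∧
      (¬ Even i.val → (h' i).toNat = (h i).toNat + ((h 0).toNat - (h' 0).toNat)) := by
    intro i
    have := key i.val i.isLt.le
    rwa [o1, o2, ofNat_val] at this
  intro k
  obtain ⟨i, rfl⟩ : ∃ i, i + 1 = k := ⟨k - 1, sub_add_cancel _ _⟩
  have h1 := key' i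
  have h2 := key' (i + 1)
  have h3 := congrFun e i
  simp only [demand] at h3
  split_ifs with hk
  · have := h2.1 hk
    omega
  · have := h2.2 hk
    rw [even_val_add_one_iff hn, not_not] at hk
    have := h1.1 hk
    omega

theorem exists_not_isShiftable_demand_eq (hn : Even n) (c : Fin n → ℤ) :
    ∃ h, ¬ IsShiftable h ∧ demand h = c := by
  have ex : ∃ p, ∃ h, demand h = c ∧ (h 0).toNat = p := by
    obtain ⟨p, hp, hmin⟩ := exists_least_orbit_le (unroll c) (NeZero.ne n)
    -- The return map is monotone, so the image of `p` also satisfies the condition that `p`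
    -- satisfies minimally; hence `p` is fixed.
    have := hmin _ ((orbit_alternating (unroll c) hp n).1 hn).1
    exact ⟨p, exists_demand_eq (le_antisymm hp this)⟩
  classical
  obtain ⟨h, hc, h0⟩ := Nat.find_spec ex
  refine ⟨h, fun hs => ?_, hc⟩
  have hs0 := hs 0
  rw [if_pos (by simp)] at hs0
  -- Shifting would give the same demand with a smaller start.
  refine Nat.find_min ex (m := Nat.find ex - 1) (by omega)
    ⟨fun k => if Even k.val then h k - 1 else h k + 1, ?_, ?_⟩
  · rw [← hc]
    funext k
    have h1 := hs k
    have h2 := hs (k + 1)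
    simp only [demand, even_val_add_one_iff hn] at h2 ⊢
    split_ifs at h1 h2 ⊢ <;> omega
  · simp only [Fin.val_zero, Even.zero, if_true]
    omega

theorem sum_ite_even {n s : ℕ} (hs : n = 2 * s) :
    ∑ k : Fin n, (if Even k.val then 1 else 0) = s := by
  subst hs
  rw [Fin.sum_univ_eq_sum_range fun k => if Even k then 1 else 0]
  induction s with
  | zero => rfl
  | succ s ih =>
    rw [show 2 * (s + 1) = 2 * s + 1 + 1 by ring, Finset.sum_range_succ, Finset.sum_range_succ, ih]
    simp

omit [NeZero n] in
theorem hasGenFun_isShiftable {s : ℕ} (hs : n = 2 * s) :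
    HasGenFun (fun h : {h : Fin n → ℤ // IsShiftable h} => ∑ k, (h.1 k).natAbs)
      ((1 - PowerSeries.X)⁻¹ ^ n * PowerSeries.X ^ s) := by
  refine ((hasGenFun_sum n).add_const s).congr
    { toFun := fun f => ⟨fun k => f k + if Even k.val then 1 else 0, fun k => by
        dsimp only
        split_ifs <;> omega⟩
      invFun := fun h k => (h.1 k - if Even k.val then 1 else 0).toNat
      left_inv := fun f => by simp
      right_inv := fun h => by
        refine Subtype.ext (funext fun k => ?_)
        have := h.2 k
        dsimp only
        split_ifs at this ⊢ <;> omega } fun f => ?_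
  have h : ∑ k, f k + s = ∑ k : Fin n, (f k + if Even k.val then 1 else 0) := by
    rw [Finset.sum_add_distrib, sum_ite_even hs]
  refine Eq.trans (Finset.sum_congr rfl fun k _ => ?_) h.symm
  simp only [Equiv.coe_fn_mk]
  split_ifs <;> omega

theorem hasGenFun_coverWeight_even {s : ℕ} (hs : n = 2 * s) :
    HasGenFun (coverWeight (n := n)) (((1 + PowerSeries.X) * (1 - PowerSeries.X)⁻¹) ^ n -
      (1 - PowerSeries.X)⁻¹ ^ n * PowerSeries.X ^ s) := by
  have hn : Even n := ⟨s, by omega⟩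
  classical
  have h := (hasGenFun_sum_natAbs n).sub (hasGenFun_isShiftable hs)
    ((Equiv.sumComm _ _).trans (Equiv.sumCompl IsShiftable))
    (w := fun h => ∑ k, (h.1 k).natAbs) (fun _ => rfl) (fun _ => rfl)
  refine h.congr (Equiv.ofBijective (fun h => demand h.1) ⟨fun h h' e => ?_, fun c => ?_⟩)
    fun h => coverWeight_demand h.1
  · refine Subtype.ext (eq_of_demand_eq e ?_)
    by_contra hne
    rcases Nat.lt_or_gt_of_ne hne with hlt | hlt
    · exact h'.2 (isShiftable_of_demand_eq hn e.symm hlt)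
    · exact h.2 (isShiftable_of_demand_eq hn e hlt)
  · obtain ⟨h, hh, e⟩ := exists_not_isShiftable_demand_eq hn c
    exact ⟨⟨h, hh⟩, e⟩

end Cover

/-! ### Cycles of odd length -/

section Odd

variable {n : ℕ} [NeZero n]

/-- The edge weights `f`, raised by one at the edge `0` and at the odd edges. -/
def raise (f : Fin n → ℕ) : Fin n → ℕ :=
  fun k => f k + if k.val = 0 ∨ ¬ Even k.val then 1 else 0

theorem raise_zero (f : Fin n → ℕ) : raise f 0 = f 0 + 1 := by simp [raise]

/-- A demand whose least integral edge cover is half a unit above its fractional one. -/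
def oddDemand (f : Fin n → ℕ) : Fin n → ℤ :=
  fun k => raise f k + raise f (k + 1) - if k = 0 then 1 else 0

theorem sum_oddDemand (f : Fin n → ℕ) : ∑ k, oddDemand f k + 1 = 2 * ∑ k, (raise f k : ℤ) := by
  simp only [oddDemand, Finset.sum_sub_distrib, Finset.sum_add_distrib]
  rw [sum_add_one fun k => (raise f k : ℤ)]
  simp
  ring

/-- The total demand is `2 ∑ raise f - 1`, so an integral cover has to round up. -/
theorem coverNumber_oddDemand (f : Fin n → ℕ) :
    coverNumber (oddDemand f) = ∑ k, raise f k := by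
  refine coverNumber_eq (fun k => ?_) fun e he => ?_
  · simp only [oddDemand]
    split_ifs <;> omega
  · have h1 := he.sum_le
    have h2 := sum_oddDemand f
    zify
    omega

theorem sum_ite_odd {n s : ℕ} (hs : n = 2 * s + 1) :
    ∑ k : Fin n, (if k.val = 0 ∨ ¬ Even k.val then 1 else 0) = s + 1 := by
  subst hs
  rw [Fin.sum_univ_eq_sum_range fun k => if k = 0 ∨ ¬ Even k then 1 else 0]
  induction s with
  | zero => rfl
  | succ s ih =>
    rw [show 2 * (s + 1) + 1 = 2 * s + 1 + 1 + 1 by ring, Finset.sum_range_succ,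
      Finset.sum_range_succ, ih]
    simp [Nat.even_add_one]

omit [NeZero n] in
theorem sum_raise {s : ℕ} (hs : n = 2 * s + 1) (f : Fin n → ℕ) :
    ∑ k, raise f k = ∑ k, f k + (s + 1) := by
  simp only [raise, Finset.sum_add_distrib]
  rw [sum_ite_odd hs]

theorem coverWeight_oddDemand {s : ℕ} (hs : n = 2 * s + 1) (f : Fin n → ℕ) :
    coverWeight (oddDemand f) = ∑ k, f k + (s + 2) := by
  have h : ∑ k, oddDemand f k + 1 = 2 * ((∑ k, f k + (s + 1) : ℕ) : ℤ) := by
    rw [sum_oddDemand, ← sum_raise hs, Nat.cast_sum]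
  rw [coverWeight, coverNumber_oddDemand, sum_raise hs]
  omega

theorem orbit_oddDemand_of_lt (f : Fin n → ℕ) {k : ℕ} (hk : k + 1 < n) :
    orbit (unroll (oddDemand f)) (f 0) (k + 1) = raise f (Fin.ofNat n (k + 1)) := by
  induction k with
  | zero =>
    rw [orbit_succ, orbit_zero, unroll, oddDemand, ofNat_succ, ofNat_zero_eq, raise_zero,
      if_pos rfl]
    omega
  | succ k ih =>
    have h0 : Fin.ofNat n (k + 1) ≠ 0 := ofNat_ne_zero (by omega) (by omega)
    rw [orbit_succ, ih (by omega), unroll, oddDemand, if_neg h0, ← ofNat_succ]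
    omega

theorem orbit_oddDemand_self (hn : 1 < n) (f : Fin n → ℕ) :
    orbit (unroll (oddDemand f)) (f 0) n = f 0 + 1 := by
  obtain ⟨m, rfl⟩ : ∃ m, n = m + 2 := ⟨n - 2, by omega⟩
  have h0 : Fin.ofNat (m + 2) (m + 1) ≠ 0 := ofNat_ne_zero (by omega) (by omega)
  rw [orbit_succ, orbit_oddDemand_of_lt f (by omega), unroll, oddDemand, if_neg h0, ← ofNat_succ,
    ofNat_self]
  simp [raise]

/-- One unit more at the start propagates with alternating sign; the units added by `raise` at odd
edges prevent truncation. So the return map swaps `f 0` and `f 0 + 1`. -/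
theorem orbit_oddDemand_succ_of_lt (f : Fin n → ℕ) {k : ℕ} (hk : k + 1 < n) :
    (orbit (unroll (oddDemand f)) (f 0 + 1) (k + 1) : ℤ) =
      raise f (Fin.ofNat n (k + 1)) + if Even (k + 1) then 1 else -1 := by
  induction k with
  | zero =>
    rw [orbit_succ, orbit_zero, unroll, oddDemand, ofNat_succ, ofNat_zero_eq]
    have h1 : (0 + 1 : Fin n) = Fin.ofNat n 1 := by rw [← ofNat_zero_eq, ← ofNat_succ]
    have h2 : raise f (0 + 1) = f (0 + 1) + 1 := by
      rw [raise, if_pos (Or.inr _)]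
      rw [h1, val_ofNat_of_lt hk]
      decide
    rw [h2, raise_zero, if_pos rfl, if_neg (by decide)]
    omega
  | succ k ih =>
    have h0 : Fin.ofNat n (k + 1) ≠ 0 := ofNat_ne_zero (by omega) (by omega)
    have ih := ih (by omega)
    have h2 : ¬ Even (k + 1 + 1) → 1 ≤ raise f (Fin.ofNat n (k + 1 + 1)) := fun h => by
      rw [raise, if_pos (Or.inr (by rwa [val_ofNat_of_lt hk]))]
      omega
    rw [orbit_succ, unroll, oddDemand, if_neg h0, ← ofNat_succ]
    by_cases h3 : Even (k + 1)
    · have h4 : ¬ Even (k + 1 + 1) := by rwa [Nat.even_add_one, not_not]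
      have := h2 h4
      rw [if_pos h3] at ih
      rw [if_neg h4]
      omega
    · rw [if_neg h3] at ih
      rw [if_pos (Nat.even_add_one.2 h3)]
      omega

theorem orbit_oddDemand_succ_self (hn : 1 < n) (hn' : ¬ Even n) (f : Fin n → ℕ) :
    orbit (unroll (oddDemand f)) (f 0 + 1) n = f 0 := by
  obtain ⟨m, rfl⟩ : ∃ m, n = m + 2 := ⟨n - 2, by omega⟩
  have h0 : Fin.ofNat (m + 2) (m + 1) ≠ 0 := ofNat_ne_zero (by omega) (by omega)
  have h1 := orbit_oddDemand_succ_of_lt f (k := m) (by omega)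
  rw [Nat.even_add_one, not_not] at hn'
  rw [if_pos hn'] at h1
  rw [orbit_succ, unroll, oddDemand, if_neg h0, ← ofNat_succ, ofNat_self, raise_zero]
  omega

theorem oddDemand_injective (hn : 1 < n) (hn' : ¬ Even n) :
    Function.Injective (oddDemand (n := n)) := by
  have le : ∀ f f' : Fin n → ℕ, oddDemand f = oddDemand f' → f 0 ≤ f' 0 := by
    intro f f' e
    by_contra! h
    have h1 := orbit_oddDemand_self hn f
    have h2 := orbit_oddDemand_succ_self hn hn' f'
    rw [← e] at h2
    -- From `f' 0 + 1 ≤ f 0`, antitonicity would give `f 0 + 1 ≤ f' 0`.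
    have := orbit_antitone_of_odd (unroll (oddDemand f)) hn' (Nat.succ_le_of_lt h)
    simp only [Nat.succ_eq_add_one] at this
    omega
  intro f f' e
  have h0 := le_antisymm (le _ _ e) (le _ _ e.symm)
  have key : ∀ k, raise f k = raise f' k := by
    intro k
    rcases Nat.eq_zero_or_pos k.val with hk | hk
    · have : k = 0 := Fin.ext (by simpa using hk)
      subst this
      simp [raise, h0]
    · have h1 := orbit_oddDemand_of_lt f (k := k.val - 1) (by have := k.isLt; omega)
      have h2 := orbit_oddDemand_of_lt f' (k := k.val - 1) (by have := k.isLt; omega)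
      rw [Nat.sub_add_cancel hk, ofNat_val] at h1 h2
      rw [← h1, ← h2, e, h0]
  funext k
  have := key k
  simp only [raise] at this
  omega

theorem demand_injective (hn' : ¬ Even n) : Function.Injective (demand (n := n)) := by
  have le : ∀ h h' : Fin n → ℤ, demand h = demand h' → (h 0).toNat ≤ (h' 0).toNat := by
    intro h h' e
    by_contra! hlt
    have h1 := orbit_demand_self h
    have h2 := orbit_demand_self h'
    rw [← e] at h2
    have := orbit_antitone_of_odd (unroll (demand h)) hn' hlt.le
    omega
  exact fun h h' e => eq_of_demand_eq e (le_antisymm (le _ _ e) (le _ _ e.symm))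

/-- An antitone map that swaps two consecutive integers has no fixed point. -/
theorem demand_ne_oddDemand (hn : 1 < n) (hn' : ¬ Even n) (h : Fin n → ℤ) (f : Fin n → ℕ) :
    demand h ≠ oddDemand f := by
  intro e
  have h1 := orbit_demand_self h
  rw [e] at h1
  have h2 := orbit_oddDemand_self hn f
  have h3 := orbit_oddDemand_succ_self hn hn' f
  rcases Nat.lt_or_ge (f 0) (h 0).toNat with hlt | hle
  · have := orbit_antitone_of_odd (unroll (oddDemand f)) hn' (Nat.succ_le_of_lt hlt)
    simp only [Nat.succ_eq_add_one] at this
    omega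
  · have := orbit_antitone_of_odd (unroll (oddDemand f)) hn' hle
    omega

theorem exists_oddDemand_eq {c : Fin n → ℤ} {p : ℕ}
    (hp : orbit (unroll c) p n = p + 1) (hp' : orbit (unroll c) (p + 1) n = p) :
    ∃ f, oddDemand f = c := by
  have key := fun k (hk : k ≤ n) => orbit_diff_eq (unroll c) (k := k) (Nat.le_succ p) (n := n)
    (by simp only [Nat.succ_eq_add_one]; omega) hk
  simp only [Nat.succ_eq_add_one, Nat.add_sub_cancel_left] at key
  -- The gap of the two orbits stays 1, so at each step the larger value is positive and its vertex
  -- is met without slack.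
  have step : ∀ k, k < n → unroll c k = orbit (unroll c) p k + orbit (unroll c) p (k + 1) := by
    intro k hk
    have h1 := orbit_succ (unroll c) p k
    have h2 := orbit_succ (unroll c) (p + 1) k
    have h3 := key k hk.le
    have h4 := key (k + 1) hk
    rw [Nat.even_add_one] at h4
    by_cases hk : Even k
    · have := h3.1 hk
      have := h4.2 (not_not.2 hk)
      omega
    · have := h3.2 hk
      have := h4.1 hk
      omega
  -- This undoes `raise` except at edge `0`, where `f 0 = p` and the raised value is the return
  -- value `p + 1`.
  let f : Fin n → ℕ := fun k => orbit (unroll c) p k.val - if Even k.val then 0 else 1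
  have hf0 : raise f 0 = p + 1 := by simp [raise, f]
  have hf : ∀ k : Fin n, k ≠ 0 → raise f k = orbit (unroll c) p k.val := by
    intro k hk
    have hk' : k.val ≠ 0 := fun h => hk (Fin.ext (by simpa using h))
    have := key k.val k.isLt.le
    simp only [raise, f, hk', false_or]
    by_cases he : Even k.val
    · simp [he]
    · have := this.2 he
      simp only [he, if_false, not_false_eq_true, if_true]
      omega
  have hf1 : ∀ k : Fin n, raise f (k + 1) = orbit (unroll c) p (k.val + 1) := by
    intro k
    rcases val_add_one_cases k with ⟨h1, -⟩ | ⟨h1, h2⟩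
    · rw [← h1]
      refine hf _ fun h => ?_
      rw [h] at h1
      simp at h1
    · rw [h1, h2, hf0, hp]
  refine ⟨f, funext fun k => ?_⟩
  have hs := step k.val k.isLt
  rw [unroll, ofNat_val] at hs
  rw [hs, oddDemand, hf1]
  split_ifs with h0
  · subst h0
    rw [hf0]
    simp
    ring
  · rw [hf k h0, sub_zero]

/-- At the least `p` with `T p ≤ p`, either `p` is fixed or `p = q + 1` with `T q > q`; in the
latter case `T q ≤ T (q + 1) + 1` leaves only the swap of `q` and `q + 1`. -/
theorem exists_demand_eq_or_oddDemand_eq (hn' : ¬ Even n) (c : Fin n → ℤ) :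
    (∃ h, demand h = c) ∨ ∃ f, oddDemand f = c := by
  obtain ⟨p, hp, hmin⟩ := exists_least_orbit_le (unroll c) (NeZero.ne n)
  rcases hp.eq_or_lt with h | h
  · obtain ⟨h, hh, -⟩ := exists_demand_eq h
    exact Or.inl ⟨h, hh⟩
  · obtain ⟨q, rfl⟩ : ∃ q, p = q + 1 := ⟨p - 1, by omega⟩
    have h1 := ((orbit_alternating (unroll c) (Nat.le_succ q) n).2 hn').2
    simp only [Nat.succ_eq_add_one] at h1
    have h2 : q < orbit (unroll c) q n := by
      by_contra! h2
      have := hmin q h2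
      omega
    exact Or.inr (exists_oddDemand_eq (p := q) (by omega) (by omega))

theorem hasGenFun_coverWeight_odd {s : ℕ} (hn : 1 < n) (hs : n = 2 * s + 1) :
    HasGenFun (coverWeight (n := n)) (((1 + PowerSeries.X) * (1 - PowerSeries.X)⁻¹) ^ n +
      (1 - PowerSeries.X)⁻¹ ^ n * PowerSeries.X ^ (s + 2)) := by
  have hn' : ¬ Even n := by
    rw [hs]
    simp
  refine ((hasGenFun_sum_natAbs n).sum ((hasGenFun_sum n).add_const (s + 2))).congr
    (Equiv.ofBijective (Sum.elim demand oddDemand) ⟨?_, fun c => ?_⟩) ?_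
  · exact (demand_injective hn').sumElim (oddDemand_injective hn hn') (demand_ne_oddDemand hn hn')
  · rcases exists_demand_eq_or_oddDemand_eq hn' c with ⟨h, hh⟩ | ⟨f, hf⟩
    · exact ⟨Sum.inl h, hh⟩
    · exact ⟨Sum.inr f, hf⟩
  · rintro (h | f)
    · exact coverWeight_demand h
    · exact coverWeight_oddDemand hs f

end Odd

/-! ### Bases of the graded components of the Rees algebra of a monomial ideal -/

section Monomial

variable {σ K : Type*} [Field K]

/-- The `K`-basis of `K[x_v : v ∈ σ][s]` that consists of the monomials. -/
noncomputable def bimonomialBasis (σ K : Type*) [Field K] :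
    Module.Basis ((σ →₀ ℕ) × ℕ) K (MvPolynomial σ K)[X] :=
  (MvPolynomial.basisMonomials σ K).smulTower (Polynomial.basisMonomials (MvPolynomial σ K))

theorem bimonomialBasis_apply (m : σ →₀ ℕ) (b : ℕ) :
    bimonomialBasis σ K (m, b) = Polynomial.monomial b (MvPolynomial.monomial m 1) := by
  simp [bimonomialBasis, Module.Basis.smulTower_apply, Polynomial.smul_monomial]

/-- The hypothesis `hI` expresses that the powers of `I` are monomial ideals, so the monomials in a
component form a basis of it. -/
theorem finrank_reesDegree (I : Ideal (MvPolynomial σ K)) (e d : ℕ)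
    (hI : ∀ b f, f ∈ I ^ b → ∀ m ∈ f.support, MvPolynomial.monomial m (1 : K) ∈ I ^ b) :
    Module.finrank K (reesDegree I e d) = Nat.card {p : (σ →₀ ℕ) × ℕ // p.2 ≤ d ∧
      p.1.degree = d - p.2 + e * p.2 ∧ MvPolynomial.monomial p.1 (1 : K) ∈ I ^ p.2} := by
  set T : Set ((σ →₀ ℕ) × ℕ) := {p | p.2 ≤ d ∧
      p.1.degree = d - p.2 + e * p.2 ∧ MvPolynomial.monomial p.1 (1 : K) ∈ I ^ p.2}
  let ι : reesAlgebra I →ₗ[K] (MvPolynomial σ K)[X] :=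
    (Subalgebra.val (reesAlgebra I)).toLinearMap.restrictScalars K
  have hι : Function.Injective ι := Subtype.val_injective
  let v : T → (MvPolynomial σ K)[X] := fun p => bimonomialBasis σ K p.1
  have hv : LinearIndependent K v :=
    (bimonomialBasis σ K).linearIndependent.comp _ Subtype.val_injective
  have key : (reesDegree I e d).map ι = Submodule.span K (Set.range v) := by
    apply le_antisymm
    · rw [Submodule.map_le_iff_le_comap, reesDegree]
      refine iSup₂_le fun ab hab => ?_
      have hab := Finset.HasAntidiagonal.mem_antidiagonal.1 hab
      rintro q ⟨f, hf, hq⟩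
      have hfI : f ∈ I ^ ab.2 := by
        have := (mem_reesAlgebra_iff I _).1 q.2 ab.2
        rwa [hq, Polynomial.coeff_monomial_same] at this
      change (q : (MvPolynomial σ K)[X]) ∈ Submodule.span K (Set.range v)
      rw [hq, MvPolynomial.as_sum f, map_sum]
      refine Submodule.sum_mem _ fun m hm => ?_
      have hmT : (m, ab.2) ∈ T := by
        refine ⟨by dsimp only; omega, ?_, hI _ _ hfI m hm⟩
        have hw : m.degree = ab.1 + e * ab.2 := by
          rw [Finsupp.degree_eq_weight_one]
          exact hf (MvPolynomial.mem_support_iff.1 hm)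
        dsimp only
        rw [hw]
        congr 1
        omega
      have : Polynomial.monomial ab.2 (MvPolynomial.monomial m (f.coeff m)) =
          f.coeff m • v ⟨(m, ab.2), hmT⟩ := by
        simp only [v, bimonomialBasis_apply, Polynomial.smul_monomial, MvPolynomial.smul_monomial,
          smul_eq_mul, mul_one]
      rw [this]
      exact Submodule.smul_mem _ _ (Submodule.subset_span ⟨_, rfl⟩)
    · rw [Submodule.span_le]
      rintro _ ⟨⟨⟨m, b⟩, hb, hm, hmI⟩, rfl⟩
      refine ⟨⟨Polynomial.monomial b (MvPolynomial.monomial m 1),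
        reesAlgebra.monomial_mem.2 hmI⟩, ?_, (bimonomialBasis_apply m b).symm⟩
      refine Submodule.mem_iSup_of_mem (d - b, b) (Submodule.mem_iSup_of_mem ?_ ?_)
      · exact Finset.HasAntidiagonal.mem_antidiagonal.2 (Nat.sub_add_cancel hb)
      · exact ⟨_, MvPolynomial.isHomogeneous_monomial _ hm, rfl⟩
  rw [(Submodule.equivMapOfInjective ι hι (reesDegree I e d)).finrank_eq, key,
    Module.finrank_eq_nat_card_basis (Module.Basis.span hv)]
  rfl

theorem span_monomial_pow {τ : Type*} [Fintype τ] (a : τ → σ →₀ ℕ) (b : ℕ) :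
    Ideal.span ((fun s => MvPolynomial.monomial s (1 : K)) '' Set.range a) ^ b =
      Ideal.span ((fun s => MvPolynomial.monomial s (1 : K)) ''
        {m | ∃ e : τ → ℕ, ∑ j, e j = b ∧ ∑ j, e j • a j = m}) := by
  classical
  induction b with
  | zero =>
    rw [pow_zero, Ideal.one_eq_top, eq_comm, Ideal.eq_top_iff_one]
    exact Ideal.subset_span ⟨0, ⟨0, by simp, by simp⟩, rfl⟩
  | succ b ih =>
    rw [pow_succ, ih, Ideal.span_mul_span']
    congr 1
    ext f
    constructor
    · rintro ⟨_, ⟨_, ⟨e, he, rfl⟩, rfl⟩, _, ⟨_, ⟨j, rfl⟩, rfl⟩, rfl⟩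
      refine ⟨_, ⟨e + Pi.single j 1, ?_, rfl⟩, ?_⟩
      · simp [Finset.sum_add_distrib, he]
      · simp [MvPolynomial.monomial_mul, add_smul, Finset.sum_add_distrib, Pi.single_apply]
    · rintro ⟨_, ⟨e, he, rfl⟩, rfl⟩
      obtain ⟨j, hj⟩ : ∃ j, e j ≠ 0 := by
        by_contra! h
        simp [h] at he
      have hej : e = (e - Pi.single j 1) + Pi.single j 1 := by
        funext i
        by_cases h : i = j
        · subst h
          simp only [Pi.add_apply, Pi.sub_apply, Pi.single_eq_same]
          omega
        · simp [h]
      refine ⟨_, ⟨_, ⟨e - Pi.single j 1, ?_, rfl⟩, rfl⟩, _, ⟨_, ⟨j, rfl⟩, rfl⟩, ?_⟩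
      · rw [hej] at he
        simp only [Pi.add_apply, Finset.sum_add_distrib, Finset.sum_pi_single',
          Finset.mem_univ, if_true] at he
        omega
      · conv_rhs => rw [hej]
        simp [MvPolynomial.monomial_mul, add_smul, Finset.sum_add_distrib, Pi.single_apply]

theorem mem_span_monomial_pow_iff {τ : Type*} [Fintype τ] (a : τ → σ →₀ ℕ) (b : ℕ)
    (f : MvPolynomial σ K) :
    f ∈ Ideal.span ((fun s => MvPolynomial.monomial s (1 : K)) '' Set.range a) ^ b ↔
      ∀ m ∈ f.support, ∃ e : τ → ℕ, ∑ j, e j = b ∧ ∑ j, e j • a j ≤ m := by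
  rw [span_monomial_pow, MvPolynomial.mem_ideal_span_monomial_image]
  simp only [Set.mem_ofPred_eq]
  refine forall₂_congr fun m _ => ⟨?_, ?_⟩
  · rintro ⟨_, ⟨e, he, rfl⟩, hm⟩
    exact ⟨e, he, hm⟩
  · rintro ⟨e, he, hm⟩
    exact ⟨_, ⟨e, he, rfl⟩, hm⟩

end Monomial

/-! ### Path ideals of cycles -/

section Cycle

variable {n : ℕ} [NeZero n]

theorem cycleGraph_adj_iff (hn : 2 ≤ n) (u v : Fin n) :
    (SimpleGraph.cycleGraph n).Adj u v ↔ v = u + 1 ∨ u = v + 1 := by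
  obtain ⟨m, rfl⟩ : ∃ m, n = m + 2 := ⟨n - 2, by omega⟩
  rw [SimpleGraph.cycleGraph_adj, sub_eq_iff_eq_add', sub_eq_iff_eq_add', or_comm]

/-- A path cannot turn back, so its first edge fixes the direction. -/
theorem support_eq_of_isPath (hn : 2 ≤ n) {u v : Fin n} (p : (SimpleGraph.cycleGraph n).Walk u v)
    (hp : p.IsPath) :
    p.support = (List.range p.support.length).map (fun k => u + Fin.ofNat n k) ∨
      p.support = (List.range p.support.length).map (fun k => u - Fin.ofNat n k) := by
  induction p with
  | nil => simp
  | @cons u u' v h p ih =>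
    rw [SimpleGraph.Walk.cons_isPath_iff] at hp
    have hlen : p.support.length = p.length + 1 := p.length_support
    rw [SimpleGraph.Walk.support_cons, List.length_cons, List.range_succ_eq_map, List.map_cons,
      List.map_cons, List.map_map, List.map_map, ofNat_zero_eq, add_zero, sub_zero,
      List.cons_inj_right, List.cons_inj_right]
    have ha : u' = u + 1 → p.support = (List.range p.support.length).map
        (fun k => u' + Fin.ofNat n k) → p.support = (List.range p.support.length).map
        ((fun k => u + Fin.ofNat n k) ∘ Nat.succ) := by
      intro hu hs
      refine hs.trans (List.map_congr_left fun k _ => ?_)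
      rw [Function.comp_apply, Nat.succ_eq_add_one, ofNat_succ, hu]
      abel
    have hb : u = u' + 1 → p.support = (List.range p.support.length).map
        (fun k => u' - Fin.ofNat n k) → p.support = (List.range p.support.length).map
        ((fun k => u - Fin.ofNat n k) ∘ Nat.succ) := by
      intro hu hs
      refine hs.trans (List.map_congr_left fun k _ => ?_)
      rw [Function.comp_apply, Nat.succ_eq_add_one, ofNat_succ, hu]
      abel
    have h1 : Fin.ofNat n 1 = 1 := by
      have := ofNat_succ (n := n) 0
      rwa [ofNat_zero_eq, zero_add, zero_add] at this
    -- A one-vertex tail fits both directions; a longer one running the opposite way would have `u`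
    -- as its second vertex.
    by_cases hl : p.length = 0
    · rw [hl] at hlen
      rcases (cycleGraph_adj_iff hn u u').1 h with hu | hu
      · left
        refine ha hu ?_
        rcases ih hp.1 with hs | hs
        · exact hs
        · rw [hs, hlen]
          simp
      · right
        refine hb hu ?_
        rcases ih hp.1 with hs | hs
        · rw [hs, hlen]
          simp
        · exact hs
    · have hmem : 1 ∈ List.range p.support.length := by
        rw [List.mem_range]
        omega
      rcases (cycleGraph_adj_iff hn u u').1 h with hu | hu
      · left
        rcases ih hp.1 with hs | hs
        · exact ha hu hs
        · refine absurd ?_ hp.2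
          rw [hs]
          exact List.mem_map.2 ⟨1, hmem, by rw [h1, hu]; abel⟩
      · right
        rcases ih hp.1 with hs | hs
        · refine absurd ?_ hp.2
          rw [hs]
          exact List.mem_map.2 ⟨1, hmem, by rw [h1, hu]⟩
        · exact hb hu hs

theorem exists_isPath_support_eq (hn : 2 ≤ n) (t : ℕ) (ht : t < n) (u : Fin n) :
    ∃ (v : Fin n) (p : (SimpleGraph.cycleGraph n).Walk u v), p.IsPath ∧
      p.support = (List.range (t + 1)).map (fun k => u + Fin.ofNat n k) := by
  induction t generalizing u with
  | zero => exact ⟨u, .nil, .nil, by simp⟩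
  | succ t ih =>
    obtain ⟨v, p, hp, hs⟩ := ih (by omega) (u + 1)
    refine ⟨v, .cons ((cycleGraph_adj_iff hn u (u + 1)).2 (Or.inl rfl)) p, ?_, ?_⟩
    · rw [SimpleGraph.Walk.cons_isPath_iff]
      refine ⟨hp, fun hu => ?_⟩
      rw [hs] at hu
      obtain ⟨k, hk, e⟩ := List.mem_map.1 hu
      rw [List.mem_range] at hk
      rw [add_assoc, add_comm 1, ← ofNat_succ, add_eq_left] at e
      exact ofNat_ne_zero (by omega) (by omega) e
    · rw [SimpleGraph.Walk.support_cons, hs, List.range_succ_eq_map (n := t + 1), List.map_cons,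
        List.map_map, ofNat_zero_eq, add_zero, List.cons_inj_right]
      refine List.map_congr_left fun k _ => ?_
      rw [Function.comp_apply, Nat.succ_eq_add_one, ofNat_succ]
      abel

/-- The exponent of the product of `t` consecutive variables, the first of which is `j`. -/
noncomputable def arc (t : ℕ) (j : Fin n) : Fin n →₀ ℕ :=
  ∑ k ∈ Finset.range t, Finsupp.single (j + Fin.ofNat n k) 1

theorem prod_map_X_eq_monomial {σ K : Type*} [Field K] (t : ℕ) (g : ℕ → σ) :
    (((List.range t).map g).map fun w => (MvPolynomial.X w : MvPolynomial σ K)).prod =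
      MvPolynomial.monomial (∑ k ∈ Finset.range t, Finsupp.single (g k) 1) 1 := by
  induction t with
  | zero => simp
  | succ t ih =>
    rw [List.range_succ, List.map_append, List.map_append, List.prod_append, ih,
      Finset.sum_range_succ, ← mul_one (1 : K), ← MvPolynomial.monomial_mul]
    simp [MvPolynomial.X]

theorem pathIdeal_cycleGraph (K : Type*) [Field K] (hn : 2 ≤ n) {t : ℕ} (ht0 : t ≠ 0)
    (ht : t ≤ n) : pathIdeal K (SimpleGraph.cycleGraph n) t =
      Ideal.span ((fun s => MvPolynomial.monomial s (1 : K)) '' Set.range (arc (n := n) t)) := by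
  rw [pathIdeal]
  congr 1
  ext f
  constructor
  · rintro ⟨u, v, p, hp, hl, rfl⟩
    rcases support_eq_of_isPath hn p hp with hs | hs
    · refine ⟨_, ⟨u, rfl⟩, ?_⟩
      rw [hs, hl, prod_map_X_eq_monomial]
      rfl
    -- A backward path is the forward arc that begins at its last vertex.
    · refine ⟨_, ⟨u - Fin.ofNat n (t - 1), rfl⟩, ?_⟩
      rw [hs, hl, prod_map_X_eq_monomial]
      refine congrArg (fun s => MvPolynomial.monomial s (1 : K)) ?_
      rw [arc, ← Finset.sum_range_reflect]
      refine Finset.sum_congr rfl fun k hk => ?_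
      rw [Finset.mem_range] at hk
      have : Fin.ofNat n (t - 1) = Fin.ofNat n k + Fin.ofNat n (t - 1 - k) := by
        apply Fin.ext
        simp only [Fin.ofNat, Fin.val_add, Nat.add_mod_mod, Nat.mod_add_mod]
        congr 1
        omega
      rw [this]
      congr 1
      abel
  · rintro ⟨_, ⟨j, rfl⟩, rfl⟩
    obtain ⟨v, p, hp, hs⟩ := exists_isPath_support_eq hn (t - 1) (by omega) j
    rw [Nat.sub_add_cancel (by omega)] at hs
    refine ⟨j, v, p, hp, by simp [hs], ?_⟩
    rw [hs, prod_map_X_eq_monomial]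
    rfl

/-- The arc misses exactly `j - 1` and `j`, the ends of edge `j`; hence the shift of its start to `j
+ 1`. -/
theorem arc_add_single_add_single (hn : 2 ≤ n) (j k : Fin n) :
    arc (n - 2) (j + 1) k + ((if j = k then 1 else 0) + if j = k + 1 then 1 else 0) = 1 := by
  have h := sum_range_ofNat (fun i : Fin n => Finsupp.single i 1 k) (j + 1)
  obtain ⟨m, hm⟩ : ∃ m, n = m + 2 := ⟨n - 2, by omega⟩
  have hr : Finset.range n = Finset.range (n - 2 + 1 + 1) := by congr 1; omega
  have e1 : j + 1 + Fin.ofNat n (n - 2 + 1) = j := by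
    rw [add_assoc, add_comm 1, ← ofNat_succ, show n - 2 + 1 + 1 = n by omega, ofNat_self, add_zero]
  have e2 : j + 1 + Fin.ofNat n (n - 2) = j - 1 := by
    rw [eq_sub_iff_add_eq, add_assoc, ← ofNat_succ, e1]
  rw [hr, Finset.sum_range_succ, Finset.sum_range_succ, e1, e2] at h
  simp only [Finsupp.single_apply, sub_eq_iff_eq_add] at h
  rw [Finset.sum_ite_eq' Finset.univ k fun _ => 1] at h
  simp only [arc, Finsupp.finsetSum_apply, Finsupp.single_apply]
  rw [if_pos (Finset.mem_univ _)] at h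
  omega

theorem sum_smul_arc (hn : 2 ≤ n) (e : Fin n → ℕ) (k : Fin n) :
    (∑ j, e j • arc (n - 2) (j + 1)) k + (e k + e (k + 1)) = ∑ j, e j := by
  have : ∀ j, e j = e j * arc (n - 2) (j + 1) k +
      ((if j = k then e j else 0) + if j = k + 1 then e j else 0) := fun j => by
    conv_lhs => rw [← mul_one (e j), ← arc_add_single_add_single hn j k]
    simp [mul_add]
  conv_rhs => rw [Finset.sum_congr rfl fun j _ => this j]
  simp [Finset.sum_add_distrib, Finsupp.finsetSum_apply]

end Cycle

/-! ### From the Rees algebra to edge covers -/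

section HilbertSeries

variable {n : ℕ} [NeZero n]

theorem pathIdeal_cycleGraph_sub_two (K : Type*) [Field K] (hn : 3 ≤ n) :
    pathIdeal K (SimpleGraph.cycleGraph n) (n - 2) =
      Ideal.span ((fun s => MvPolynomial.monomial s (1 : K)) ''
        Set.range fun j : Fin n => arc (n - 2) (j + 1)) := by
  rw [pathIdeal_cycleGraph K (by omega) (by omega) (by omega)]
  congr 2
  exact ((Equiv.addRight (1 : Fin n)).surjective.range_comp (arc (n - 2))).symm

theorem mem_pathIdeal_pow_iff (K : Type*) [Field K] (hn : 3 ≤ n) (b : ℕ)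
    (f : MvPolynomial (Fin n) K) :
    f ∈ pathIdeal K (SimpleGraph.cycleGraph n) (n - 2) ^ b ↔
      ∀ m ∈ f.support, ∃ e, IsCover (fun k => (b : ℤ) - m k) e ∧ ∑ k, e k = b := by
  rw [pathIdeal_cycleGraph_sub_two K hn, mem_span_monomial_pow_iff]
  refine forall₂_congr fun m _ => exists_congr fun e => ?_
  rw [and_comm]
  refine and_congr_left fun he => ?_
  refine forall_congr' fun k => ?_
  have := sum_smul_arc (by omega : 2 ≤ n) e k
  dsimp only at this ⊢
  omega

theorem monomial_mem_pathIdeal_pow_iff (K : Type*) [Field K] (hn : 3 ≤ n) (b : ℕ)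
    (m : Fin n →₀ ℕ) :
    MvPolynomial.monomial m (1 : K) ∈ pathIdeal K (SimpleGraph.cycleGraph n) (n - 2) ^ b ↔
      ∃ e, IsCover (fun k => (b : ℤ) - m k) e ∧ ∑ k, e k = b := by
  classical
  rw [mem_pathIdeal_pow_iff K hn, MvPolynomial.support_monomial, if_neg one_ne_zero]
  simp

/-- Makes `b - c k` nonnegative, so that every coverable demand comes from a monomial. -/
theorem IsCover.le_sum (hn : 2 ≤ n) {c : Fin n → ℤ} {e : Fin n → ℕ} (he : IsCover c e)
    (k : Fin n) : c k ≤ ((∑ j, e j : ℕ) : ℤ) := by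
  have := he k
  have := sum_smul_arc hn e k
  omega

theorem reesHilbertSeries_eq (K : Type*) [Field K] (hn : 3 ≤ n) {f : PowerSeries ℚ}
    (hf : HasGenFun (coverWeight (n := n)) f) :
    reesHilbertSeries (pathIdeal K (SimpleGraph.cycleGraph n) (n - 2)) (n - 2) =
      f * (1 - PowerSeries.X ^ 3)⁻¹ := by
  ext d
  rw [reesHilbertSeries, PowerSeries.coeff_mk, (hasGenFun_cover hf).coeff_eq, finrank_reesDegree]
  · refine congrArg _ (Nat.card_congr ?_)
    have deg : ∀ (m : Fin n →₀ ℕ) (b : ℕ), ∑ k, ((b : ℤ) - m k) = n * b - (m.degree : ℤ) := by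
      intro m b
      rw [Finset.sum_sub_distrib, Finsupp.degree_eq_sum]
      simp
    have mul : ∀ b : ℕ, ((n - 2 : ℕ) * b : ℤ) = n * b - 2 * b := by
      intro b
      rw [Nat.cast_sub (by omega)]
      push_cast
      ring
    exact
      { toFun := fun p => ⟨⟨(fun k => (p.1.2 : ℤ) - p.1.1 k, p.1.2),
          (monomial_mem_pathIdeal_pow_iff K hn _ _).1 p.2.2.2⟩, by
            have h1 := p.2.1
            have h2 := p.2.2.1
            dsimp only
            rw [deg, h2]
            push_cast
            rw [mul]
            omega⟩
        invFun := fun q => ⟨(Finsupp.equivFunOnFinite.symm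
            fun k => ((q.1.1.2 : ℤ) - q.1.1.1 k).toNat, q.1.1.2), by
          obtain ⟨⟨⟨c, b⟩, e, he, hb⟩, hd⟩ := q
          dsimp only at he hb hd ⊢
          have hc : (fun k => (b : ℤ) - (Finsupp.equivFunOnFinite.symm
              (fun k => ((b : ℤ) - c k).toNat) : Fin n →₀ ℕ) k) = c := by
            funext k
            have := he.le_sum (by omega) k
            simp only [Finsupp.equivFunOnFinite_symm_apply_apply]
            omega
          have hdeg : ∑ k, c k = n * b - ((Finsupp.equivFunOnFinite.symm fun k =>
              ((b : ℤ) - c k).toNat : Fin n →₀ ℕ).degree : ℤ) := by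
            rw [← deg, hc]
          -- Gives `∑ c ≤ 2 b`, hence `b ≤ 3 b - ∑ c = d`.
          have hsum := he.sum_le
          rw [← Nat.cast_sum, hb] at hsum
          refine ⟨by omega, ?_, ?_⟩
          · zify [show b ≤ d by omega]
            rw [mul]
            omega
          · rw [monomial_mem_pathIdeal_pow_iff K hn, hc]
            exact ⟨e, he, hb⟩⟩
        left_inv := fun p => by
          refine Subtype.ext (Prod.ext (Finsupp.ext fun k => ?_) rfl)
          simp
        right_inv := fun q => by
          obtain ⟨⟨⟨c, b⟩, e, he, hb⟩, hd⟩ := q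
          refine Subtype.ext (Subtype.ext (Prod.ext (funext fun k => ?_) rfl))
          have := he.le_sum (by omega) k
          dsimp only at hb this ⊢
          simp only [Finsupp.equivFunOnFinite_symm_apply_apply]
          omega }
  · intro b f hf m hm
    rw [monomial_mem_pathIdeal_pow_iff K hn]
    exact (mem_pathIdeal_pow_iff K hn b f).1 hf m hm

end HilbertSeries

end PathRees

/-! ### Simplification of the rational functions -/

theorem mainTheorem7 (K : Type*) [Field K] (n : ℕ) (hn : 3 ≤ n) :
    (∀ s : ℕ, n = 2 * s + 1 →
      PathRees.reesHilbertSeries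
          (PathRees.pathIdeal K (SimpleGraph.cycleGraph n) (n - 2)) (n - 2) =
        ((∑ k ∈ Finset.range s,
            (1 + PowerSeries.X) ^ (2 * k + 1) * PowerSeries.X ^ (s - 1 - k)) +
          PowerSeries.X ^ s) * ((1 - PowerSeries.X) ^ (2 * s + 2))⁻¹) ∧
    (∀ s : ℕ, n = 2 * s →
      PathRees.reesHilbertSeries
          (PathRees.pathIdeal K (SimpleGraph.cycleGraph n) (n - 2)) (n - 2) =
        (∑ k ∈ Finset.range s,
            (1 + PowerSeries.X) ^ (2 * k) * PowerSeries.X ^ (s - 1 - k)) *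
          ((1 - PowerSeries.X) ^ (2 * s + 1))⁻¹) := by
  have : NeZero n := ⟨by omega⟩
  have geom : ∀ s : ℕ, (∑ k ∈ Finset.range s, (1 + PowerSeries.X : PowerSeries ℚ) ^ (2 * k) *
      PowerSeries.X ^ (s - 1 - k)) * (1 + PowerSeries.X + PowerSeries.X ^ 2) =
      (1 + PowerSeries.X) ^ (2 * s) - PowerSeries.X ^ s := by
    intro s
    have := geom_sum₂_mul ((1 + PowerSeries.X : PowerSeries ℚ) ^ 2) PowerSeries.X s
    simp only [← pow_mul] at this
    rw [← this]
    ring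
  have h1 : (1 - PowerSeries.X : PowerSeries ℚ)⁻¹ * (1 - PowerSeries.X) = 1 :=
    PowerSeries.inv_mul_cancel _ (by simp)
  refine ⟨fun s hs => ?_, fun s hs => ?_⟩
  · rw [PathRees.reesHilbertSeries_eq K hn (PathRees.hasGenFun_coverWeight_odd (by omega) hs),
      PowerSeries.eq_mul_inv_iff_mul_eq (by simp), mul_right_comm, eq_comm,
      PowerSeries.eq_mul_inv_iff_mul_eq (by simp), hs]
    have h2 : ((1 - PowerSeries.X : PowerSeries ℚ)⁻¹) ^ (2 * s + 1) *
        (1 - PowerSeries.X) ^ (2 * s + 1) = 1 := by rw [← mul_pow, h1, one_pow]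
    have h3 : ∑ k ∈ Finset.range s, (1 + PowerSeries.X : PowerSeries ℚ) ^ (2 * k + 1) *
        PowerSeries.X ^ (s - 1 - k) = (1 + PowerSeries.X) * ∑ k ∈ Finset.range s,
          (1 + PowerSeries.X : PowerSeries ℚ) ^ (2 * k) * PowerSeries.X ^ (s - 1 - k) := by
      rw [Finset.mul_sum]
      exact Finset.sum_congr rfl fun k _ => by ring
    rw [h3, mul_pow]
    -- Rests on `(1 + z)^(2s+1) + z^(s+2) = (1 + z) ((1 + z)^(2s) - z^s) + z^s (1 + z + z²)`.
    linear_combination (1 - PowerSeries.X) * (1 + PowerSeries.X) * geom s -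
      (1 - PowerSeries.X) * ((1 + PowerSeries.X) ^ (2 * s + 1) + PowerSeries.X ^ (s + 2)) * h2
  · rw [PathRees.reesHilbertSeries_eq K hn (PathRees.hasGenFun_coverWeight_even hs),
      PowerSeries.eq_mul_inv_iff_mul_eq (by simp), mul_right_comm, eq_comm,
      PowerSeries.eq_mul_inv_iff_mul_eq (by simp), hs]
    have h2 : ((1 - PowerSeries.X : PowerSeries ℚ)⁻¹) ^ (2 * s) *
        (1 - PowerSeries.X) ^ (2 * s) = 1 := by rw [← mul_pow, h1, one_pow]
    rw [mul_pow]
    linear_combination (1 - PowerSeries.X) * geom s -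
      (1 - PowerSeries.X) * ((1 + PowerSeries.X) ^ (2 * s) - PowerSeries.X ^ s) * h2
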